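/- Let $G$ be the bipartite graph with left vertex class $\{v_i : i\ge 1\}$, right vertex class $\{A_i : i\ge 1\}$ and edge set $$E(G)=\{v_1A_1,\,v_2A_1,\,v_1A_3,\,v_2A_3\}\cup\{v_{2i-3}A_i,\,v_{2i-2}A_i,\,v_{2i-1}A_i,\,v_{2i}A_i : i\ge 2\}.$$ Then $G$ is left locally finite (every $v_i$ has finite degree), the subsets of $\{v_i : i\ge 1\}$ that can be covered by a matching of $G$ are the independent sets of a finitary matroid $M=M_T(G)$ on $\{v_i : i\ge 1\}$, and $M$ is not dual to any strict gammoid, i.e. $M^*$ is not a strict gammoid. Here a matroid (possibly infinite) is *finitary* if a set is independent whenever all its finite subsets are. A *dimaze* $(D,B_0)$ is a digraph $D$ without loops or parallel edges together with a set $B_0\subseteq V(D)$ of sinks. A set $X\subseteq V(D)$ is *linkable* if there are pairwise vertex-disjoint finite directed (possibly trivial) paths, one starting at each vertex of $X$, all ending in $B_0$. A *strict gammoid* is a matroid isomorphic to a matroid $M_L(D,B_0)$ on $V(D)$ whose independent sets are the linkable sets of some dimaze $(D,B_0)$. -/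

import Mathlib

open Set

/-- A bipartite graph with left vertex class `V` and right vertex class `W`;
`Adj v w` says that `vw` is an edge. -/
structure BipartiteGraph (V W : Type*) where
  Adj : V → W → Prop

namespace BipartiteGraph

/-- Every left vertex has finite degree. -/
def LeftLocallyFinite {V W : Type*} (G : BipartiteGraph V W) : Prop :=
  ∀ v : V, {w : W | G.Adj v w}.Finite

/-- A set `I` of left vertices is matchable if some matching of `G` covers exactly `I` in the
left class, i.e. each vertex in `I` can be sent to a neighbour of it, injectively. -/
def Matchable {V W : Type*} (G : BipartiteGraph V W) (I : Set V) : Prop :=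
  ∃ m : I → W, Function.Injective m ∧ ∀ v : I, G.Adj v (m v)

/-- `M = M_T(G)`: the ground set is the left class, and the independent sets are the matchable
sets. There is at most one such matroid. -/
def IsTransversalMatroidOf {V W : Type*} (G : BipartiteGraph V W) (M : Matroid V) : Prop :=
  M.E = univ ∧ ∀ I : Set V, M.Indep I ↔ G.Matchable I

end BipartiteGraph

/-- A dimaze: a digraph without loops on the vertex set `V` together with a set of sinks,
called exits. (A `Digraph` has no parallel edges.) -/
structure Dimaze (V : Type*) where
  digraph : Digraph V
  loopless : ∀ v : V, ¬ digraph.Adj v v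
  exits : Set V
  sinks : ∀ b ∈ exits, ∀ v : V, ¬ digraph.Adj b v

namespace Dimaze

/-- The list `p` of vertices is a (finite, directed) path with initial vertex `a` and
terminal vertex `b`. It is trivial if `a = b`. -/
def IsPath {V : Type*} (D : Dimaze V) (p : List V) (a b : V) : Prop :=
  p.IsChain D.digraph.Adj ∧ p.Nodup ∧ p.head? = some a ∧ p.getLast? = some b

/-- A set `A` of vertices is linkable if there are pairwise vertex-disjoint paths, one from each
vertex of `A`, that all end in exits. -/
def Linkable {V : Type*} (D : Dimaze V) (A : Set V) : Prop :=
  ∃ P : A → List V,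
    (∀ a : A, ∃ b ∈ D.exits, D.IsPath (P a) a b) ∧
    Pairwise fun a a' : A => (P a).Disjoint (P a')

end Dimaze

/-- A strict gammoid: a matroid isomorphic to the pair of the vertex set and the linkable sets of
some dimaze. -/
def Matroid.IsStrictGammoid.{u} {α : Type u} (M : Matroid α) : Prop :=
  ∃ (V : Type u) (D : Dimaze V) (e : M.E ≃ V),
    ∀ I : Set M.E, M.Indep (Subtype.val '' I) ↔ D.Linkable (e '' I)

/-- The bipartite graph with left vertices `v₁, v₂, …` and right vertices `A₁, A₂, …` and edges
`v₁A₁`, `v₂A₁`, `v₁A₃`, `v₂A₃`, and `v_{2i-3}A_i`, `v_{2i-2}A_i`, `v_{2i-1}A_i`, `v_{2i}A_i`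
for all `i ≥ 2`. Here `Adj k i` stands for the edge `v_k A_i`. -/
def exampleGraph : BipartiteGraph ℕ+ ℕ+ where
  Adj k i :=
    (k = 1 ∧ i = 1) ∨ (k = 2 ∧ i = 1) ∨ (k = 1 ∧ i = 3) ∨ (k = 2 ∧ i = 3) ∨
    (2 ≤ (i : ℕ) ∧
      ((k : ℕ) = 2 * i - 3 ∨ (k : ℕ) = 2 * i - 2 ∨ (k : ℕ) = 2 * i - 1 ∨ (k : ℕ) = 2 * i))

/-!
The left vertices of the example graph come in pairs `P_j` (`vertexPair j`), and a transversal of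
the pairs is independent in `M` but not spanning: the matching that sends each of its vertices to
the second right vertex of its pair can be extended by the other member of `P_0`. So the
complement of a transversal is dependent in `M✶`, and it is enough to show that every dimaze `D`
on the same vertices whose matroid is `M✶` links the complement of some transversal.

Let `D.outGraph` join a vertex `v` to every non-exit `w` with `v = w` or `w → v` in `D`. Moving the
non-exits of a linkage one step along its paths is a matching of `D.outGraph` covering all
non-exits on the right (a *shift*), and a shift comes from a linkage as soon as it has no infinite
orbit (`Dimaze.Linkable.exists_isShift`, `Dimaze.IsShift.linkable`). Since the non-exits form a base
of `M` and a finite set can be matched by altering the identity shift in finitely many places,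
the finite sets matchable in `D.outGraph` are exactly the finite independent sets of `M`
(`Dimaze.matchable_of_indep`, `Dimaze.indep_of_matchable`).

This almost determines `D.outGraph`. By Hall's theorem the circuit `P_j ∪ P_{j+1}` has exactly
three neighbours. As `P_j ∪ P_{j+2}` has at least four, every pair but `P_0` has exactly two
neighbours, and `P_j` has one neighbour `a_j` that is not a neighbour of `P_{j+1}`. Every non-exit
is some `a_j`, both members of `P_j` are adjacent to `a_j`, and `a_j ∈ P_j` if `P_j` has no exits
(`mem_vertexPair_of_disjoint_exits`).

Now choose from each `P_j` an exit `t_j` if there is one, and `t_j = a_j` otherwise. The shift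
`a_j ↦ t_j` fixes `a_j` or sends it to an exit, so it has no infinite orbit, and it links the
complement of `{t_j}` (`exists_linkable_compl_subset`). That `M_T(G)` is a finitary matroid in the
first place holds for every left locally finite bipartite graph, by Hall's theorem for infinite
families of finite sets (`BipartiteGraph.LeftLocallyFinite.exists_matroid`).
-/

/-! ### Matchings, Hall's theorem and the transversal matroid -/

namespace BipartiteGraph

variable {V W : Type*} {G : BipartiteGraph V W} {I J S : Set V}

/-- The set of all neighbours of members of `S`. -/
def nbr (G : BipartiteGraph V W) (S : Set V) : Set W := {w | ∃ v ∈ S, G.Adj v w}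

lemma nbr_mono (h : I ⊆ J) : G.nbr I ⊆ G.nbr J :=
  fun _ ⟨v, hv, hw⟩ => ⟨v, h hv, hw⟩

lemma nbr_union : G.nbr (I ∪ J) = G.nbr I ∪ G.nbr J := by
  ext w
  simp only [nbr, mem_union, mem_ofPred_eq, or_and_right, exists_or]

lemma finite_nbr (hI : I.Finite) (h : ∀ v ∈ I, {w | G.Adj v w}.Finite) : (G.nbr I).Finite := by
  refine (hI.biUnion h).subset ?_
  rintro w ⟨v, hv, hw⟩
  exact mem_biUnion hv hw

lemma Matchable.mono (hJ : G.Matchable J) (h : I ⊆ J) : G.Matchable I := by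
  obtain ⟨m, hm, hadj⟩ := hJ
  exact ⟨fun v => m ⟨v, h v.2⟩, fun a b hab => by simpa [Subtype.ext_iff] using hm hab,
    fun v => hadj ⟨v, h v.2⟩⟩

lemma matchable_of_injOn {f : V → W} (hf : InjOn f I) (h : ∀ v ∈ I, G.Adj v (f v)) :
    G.Matchable I :=
  ⟨fun v => f v, fun a b hab => Subtype.ext (hf a.2 b.2 hab), fun v => h v v.2⟩

lemma Matchable.exists_injOn [Nonempty W] (h : G.Matchable I) :
    ∃ f : V → W, InjOn f I ∧ ∀ v ∈ I, G.Adj v (f v) := by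
  classical
  obtain ⟨m, hm, hadj⟩ := h
  refine ⟨fun v => if hv : v ∈ I then m ⟨v, hv⟩ else Classical.arbitrary W, ?_, ?_⟩
  · intro a ha b hb hab
    simp only [ha, hb, dif_pos] at hab
    simpa using hm hab
  · intro v hv
    simpa only [hv, dif_pos] using hadj ⟨v, hv⟩

lemma Matchable.ncard_le [Nonempty W] (h : G.Matchable I) (hfin : (G.nbr I).Finite) :
    I.ncard ≤ (G.nbr I).ncard := by
  obtain ⟨f, hf, hadj⟩ := h.exists_injOn
  rw [← hf.ncard_image]
  exact ncard_le_ncard (image_subset_iff.2 fun v hv => ⟨v, hv, hadj v hv⟩) hfin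

/-- Hall's theorem, in the form of a finite violating set. -/
lemma exists_ncard_nbr_lt (h : ∀ v ∈ I, {w | G.Adj v w}.Finite) (hI : ¬ G.Matchable I) :
    ∃ S ⊆ I, S.Finite ∧ (G.nbr S).ncard < S.ncard := by
  classical
  by_contra! hcon
  refine hI ?_
  obtain ⟨f, hf, hadj⟩ := (Finset.all_card_le_biUnion_card_iff_exists_injective
    (fun v : I => (h v v.2).toFinset)).1 (by
      intro s
      have h1 := hcon (Subtype.val '' (s : Set I)) (by simp) (s.finite_toSet.image _)
      rw [ncard_image_of_injective _ Subtype.val_injective, ncard_coe_finset] at h1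
      refine h1.trans_eq ?_
      rw [← ncard_coe_finset]
      congr 1
      ext w
      simp [nbr])
  exact ⟨f, hf, fun v => by simpa using hadj v⟩

lemma finite_and_ncard_nbr_lt_of_circuit [Nonempty W] (hI : I.Finite) (hdep : ¬ G.Matchable I)
    (hmin : ∀ v ∈ I, G.Matchable (I \ {v})) :
    (G.nbr I).Finite ∧ (G.nbr I).ncard < I.ncard := by
  have hfin : ∀ v ∈ I, {w | G.Adj v w}.Finite := by
    intro v hv
    by_contra hinf
    obtain ⟨f, hf, hadj⟩ := (hmin v hv).exists_injOn
    -- a vertex with infinitely many neighbours can be matched last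
    obtain ⟨w, hvw, hw⟩ := (Set.Infinite.sdiff hinf (hI.sdiff.image f)).nonempty
    classical
    refine hdep (matchable_of_injOn (f := Function.update f v w) ?_ ?_)
    · intro a ha b hb hab
      by_cases hav : a = v <;> by_cases hbv : b = v
      · rw [hav, hbv]
      · subst hav
        rw [Function.update_self, Function.update_of_ne hbv] at hab
        exact (hw ⟨b, ⟨hb, hbv⟩, hab.symm⟩).elim
      · subst hbv
        rw [Function.update_self, Function.update_of_ne hav] at hab
        exact (hw ⟨a, ⟨ha, hav⟩, hab⟩).elim
      · rw [Function.update_of_ne hbv, Function.update_of_ne hav] at hab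
        exact hf ⟨ha, hav⟩ ⟨hb, hbv⟩ hab
    · intro a ha
      by_cases hav : a = v
      · subst hav
        simpa using hvw
      · rw [Function.update_of_ne hav]
        exact hadj a ⟨ha, hav⟩
  refine ⟨finite_nbr hI hfin, ?_⟩
  obtain ⟨S, hSI, hS, hlt⟩ := exists_ncard_nbr_lt hfin hdep
  rcases hSI.eq_or_ssubset with rfl | hss
  · exact hlt
  · obtain ⟨v, hv, hvS⟩ := exists_of_ssubset hss
    have := ((hmin v hv).mono (subset_sdiff_singleton hSI hvS)).ncard_le
      (finite_nbr hS fun v hv => hfin v (hSI hv))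
    omega

/-- The augmentation property. If no element of `J \ I` can be added to `I`, then every such
element has, by Hall's theorem, all its neighbours in the partners `f '' S` of a tight
set `S ⊆ I`; the union of the tight subsets of `I` is tight again, and counting partners of `J`
gives `|J| ≤ |I|`. -/
lemma Matchable.exists_insert [Nonempty W] (hG : G.LeftLocallyFinite) (hI : G.Matchable I)
    (hIfin : I.Finite) (hJ : G.Matchable J) (hJfin : J.Finite) (hlt : I.ncard < J.ncard) :
    ∃ e ∈ J, e ∉ I ∧ G.Matchable (insert e I) := by
  by_contra! hcon
  obtain ⟨f, hf, hfadj⟩ := hI.exists_injOn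
  obtain ⟨g, hg, hgadj⟩ := hJ.exists_injOn
  have htight : ∀ e ∈ J, e ∉ I → ∃ S ⊆ I, G.nbr (insert e S) ⊆ f '' S := by
    intro e he heI
    obtain ⟨S, hSI, hS, hS'⟩ := exists_ncard_nbr_lt (fun v _ => hG v) (hcon e he heI)
    have hnS : (G.nbr S).Finite := finite_nbr hS fun v _ => hG v
    have heS : e ∈ S := by
      by_contra heS
      have := (hI.mono ((subset_insert_iff_of_notMem heS).1 hSI)).ncard_le hnS
      omega
    have hsub : S \ {e} ⊆ I := by rwa [sdiff_singleton_subset_iff]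
    refine ⟨S \ {e}, hsub, ?_⟩
    rw [insert_sdiff_singleton, insert_eq_of_mem heS]
    refine (eq_of_subset_of_ncard_le ?_ ?_ hnS).ge
    · exact image_subset_iff.2 fun v hv => ⟨v, hv.1, hfadj v (hsub hv)⟩
    · rw [(hf.mono hsub).ncard_image]
      have := ncard_sdiff_singleton_add_one heS hS
      omega
  set T : Set V := {x | ∃ S ⊆ I, x ∈ S ∧ G.nbr S ⊆ f '' S} with hT
  have hTI : T ⊆ I := fun x ⟨S, hS, hx, _⟩ => hS hx
  have hST : ∀ S ⊆ I, G.nbr S ⊆ f '' S → S ⊆ T := fun S hS hn x hx => ⟨S, hS, hx, hn⟩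
  have hTfin : T.Finite := hIfin.subset hTI
  have hmaps : g '' ((J \ I) ∪ (J ∩ T)) ⊆ f '' T := by
    rintro _ ⟨x, ⟨hxJ, hxI⟩ | ⟨hxJ, S, hSI, hxS, hS⟩, rfl⟩
    · obtain ⟨S, hSI, hS⟩ := htight x hxJ hxI
      have hST' := hST S hSI ((nbr_mono (subset_insert _ _)).trans hS)
      exact image_mono hST' (hS ⟨x, mem_insert _ _, hgadj x hxJ⟩)
    · exact image_mono (hST S hSI hS) (hS ⟨x, hxS, hgadj x hxJ⟩)
  have h1 := ncard_le_ncard hmaps (hTfin.image f)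
  rw [(hg.mono (union_subset sdiff_subset inter_subset_left)).ncard_image,
    (hf.mono hTI).ncard_image] at h1
  have h2 : J ⊆ ((J \ I) ∪ (J ∩ T)) ∪ (I \ T) := by
    intro x hx
    by_cases hxI : x ∈ I <;> by_cases hxT : x ∈ T <;> simp [hx, hxI, hxT]
  have h3 := ncard_le_ncard h2
    ((hJfin.sdiff.union (hJfin.subset inter_subset_left)).union hIfin.sdiff)
  have h4 := ncard_union_le ((J \ I) ∪ (J ∩ T)) (I \ T)
  have h5 := ncard_sdiff_add_ncard_of_subset hTI hIfin
  omega

lemma matchable_of_forall_finite [Nonempty W] (hG : G.LeftLocallyFinite)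
    (h : ∀ J ⊆ I, J.Finite → G.Matchable J) : G.Matchable I := by
  by_contra hI
  obtain ⟨S, hSI, hS, hlt⟩ := exists_ncard_nbr_lt (fun v _ => hG v) hI
  have := (h S hSI hS).ncard_le (finite_nbr hS fun v _ => hG v)
  omega

lemma LeftLocallyFinite.exists_matroid [Nonempty W] (hG : G.LeftLocallyFinite) :
    ∃ M : Matroid V, G.IsTransversalMatroidOf M ∧ M.Finitary := by
  refine ⟨(IndepMatroid.ofFinitaryCardAugment univ G.Matchable
    (matchable_of_injOn (f := fun _ => Classical.arbitrary W) (by simp) (by simp))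
    (fun _ _ h => h.mono)
    (fun _ _ hI hIfin hJ hJfin hlt => hI.exists_insert hG hIfin hJ hJfin hlt)
    (fun _ h => matchable_of_forall_finite hG h) (fun _ _ => subset_univ _)).matroid,
    ⟨rfl, fun I => Iff.rfl⟩, inferInstance⟩

end BipartiteGraph

/-! ### Linkages of a dimaze as matchings -/

namespace Dimaze

variable {V : Type*} {D : Dimaze V} {X C : Set V} {f : V → V}

/-- The bipartite graph, with `V` as both vertex classes, in which a vertex `v` on the left is
joined to a non-exit `w` on the right if `v` is `w` or an out-neighbour of `w`. -/
def outGraph (D : Dimaze V) : BipartiteGraph V V where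
  Adj v w := w ∉ D.exits ∧ (v = w ∨ D.digraph.Adj w v)

/-- `f` sends every non-exit to itself or to an out-neighbour, and distinct non-exits to
distinct vertices. Such maps are the matchings of `D.outGraph` that cover all non-exits. -/
structure IsShift (D : Dimaze V) (f : V → V) : Prop where
  injOn : InjOn f D.exitsᶜ
  adj : ∀ b ∉ D.exits, f b = b ∨ D.digraph.Adj b (f b)

lemma IsShift.outGraph_adj (hf : D.IsShift f) {b : V} (hb : b ∉ D.exits) :
    D.outGraph.Adj (f b) b := ⟨hb, hf.adj b hb⟩

/-- Moving every non-exit on a path of a linkage to its successor, and fixing the others, gives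
a shift that avoids the initial vertices. A vertex that is neither initial nor a value of the
shift is an exit off the linkage, and so can be added as a trivial path. -/
lemma Linkable.exists_isShift (hX : D.Linkable X) :
    ∃ f, D.IsShift f ∧ (∀ b ∉ D.exits, f b ∉ X) ∧
      ∀ y ∉ X, y ∉ f '' D.exitsᶜ → D.Linkable (insert y X) := by
  classical
  obtain ⟨P, hP, hdisj⟩ := hX
  have hsame : ∀ {a a' : X} {v : V}, v ∈ P a → v ∈ P a' → a = a' := by
    intro a a' v hv hv'
    by_contra hne
    exact hdisj hne hv hv'
  have hpos : ∀ a : X, ∃ h : 0 < (P a).length, (P a)[0] = a := by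
    intro a
    obtain ⟨b, hb, hchain, hnd, hhead, hlast⟩ := hP a
    obtain ⟨t, ht⟩ := List.head?_eq_some_iff.1 hhead
    refine ⟨by simp [ht], by simp [ht]⟩
  let Next : V → V → Prop := fun u w =>
    ∃ (a : X) (i : ℕ) (h : i + 1 < (P a).length), (P a)[i] = u ∧ (P a)[i + 1] = w
  have hNadj : ∀ {u w}, Next u w → D.digraph.Adj u w := by
    rintro u w ⟨a, i, h, rfl, rfl⟩
    obtain ⟨b, hb, hchain, hnd, hhead, hlast⟩ := hP a
    exact List.isChain_iff_getElem.1 hchain i h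
  have hNex : ∀ {a : X} {u : V}, u ∈ P a → u ∉ D.exits → ∃ w, Next u w := by
    intro a u hu hue
    obtain ⟨b, hb, hchain, hnd, hhead, hlast⟩ := hP a
    obtain ⟨i, hi, rfl⟩ := List.getElem_of_mem hu
    by_cases h : i + 1 < (P a).length
    · exact ⟨_, a, i, h, rfl, rfl⟩
    · exfalso
      apply hue
      rw [List.getLast?_eq_getElem?, List.getElem?_eq_some_iff] at hlast
      obtain ⟨h', h''⟩ := hlast
      have : i = (P a).length - 1 := by omega
      subst this
      rwa [h'']
  have hNr : ∀ {u w w'}, Next u w → Next u w' → w = w' := by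
    rintro u w w' ⟨a, i, h, rfl, rfl⟩ ⟨a', i', h', he, rfl⟩
    obtain rfl : a = a' := hsame (List.getElem_mem (by omega)) (he ▸ List.getElem_mem (by omega))
    obtain ⟨b, hb, hchain, hnd, hhead, hlast⟩ := hP a
    obtain rfl := hnd.getElem_inj_iff.1 he
    rfl
  have hNl : ∀ {u u' w}, Next u w → Next u' w → u = u' := by
    rintro u u' w ⟨a, i, h, rfl, rfl⟩ ⟨a', i', h', rfl, he⟩
    obtain rfl : a = a' := hsame (List.getElem_mem h) (he ▸ List.getElem_mem h')
    obtain ⟨b, hb, hchain, hnd, hhead, hlast⟩ := hP a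
    have := hnd.getElem_inj_iff.1 he
    obtain rfl : i' = i := by omega
    rfl
  have hNX : ∀ {u w}, Next u w → w ∉ X := by
    rintro u w ⟨a, i, h, rfl, rfl⟩ hw
    obtain ⟨h0, h0'⟩ := hpos ⟨_, hw⟩
    have ha : a = ⟨_, hw⟩ :=
      hsame (List.getElem_mem h) (by
        have := List.getElem_mem h0
        rwa [h0'] at this)
    obtain ⟨b, hb, hchain, hnd, hhead, hlast⟩ := hP a
    obtain ⟨h1, h1'⟩ := hpos a
    have h2 : (P a)[0] = (P a)[i + 1] := by
      rw [h1']
      exact congrArg Subtype.val ha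
    have := hnd.getElem_inj_iff.1 h2
    omega
  have hNP : ∀ {u w}, Next u w → ∃ a, w ∈ P a := by
    rintro u w ⟨a, i, h, rfl, rfl⟩
    exact ⟨a, List.getElem_mem h⟩
  have hXP : ∀ a : X, (a : V) ∈ P a := by
    intro a
    obtain ⟨h1, h1'⟩ := hpos a
    have := List.getElem_mem h1
    rwa [h1'] at this
  let f : V → V := fun b => if h : ∃ w, Next b w then h.choose else b
  have hf1 : ∀ {b}, (∃ w, Next b w) → Next b (f b) := by
    intro b h
    simp only [f, dif_pos h]
    exact h.choose_spec
  have hf2 : ∀ {b}, (¬ ∃ w, Next b w) → f b = b := fun h => by simp only [f, dif_neg h]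
  refine ⟨f, ⟨?_, ?_⟩, ?_, ?_⟩
  · intro b hb b' hb' he
    by_cases h : ∃ w, Next b w <;> by_cases h' : ∃ w, Next b' w
    · exact hNl (hf1 h) (he ▸ hf1 h')
    · obtain ⟨a, ha⟩ := hNP (hf1 h)
      rw [he, hf2 h'] at ha
      exact (h' (hNex ha hb')).elim
    · obtain ⟨a, ha⟩ := hNP (hf1 h')
      rw [← he, hf2 h] at ha
      exact (h (hNex ha hb)).elim
    · rwa [hf2 h, hf2 h'] at he
  · intro b hb
    by_cases h : ∃ w, Next b w
    · exact Or.inr (hNadj (hf1 h))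
    · exact Or.inl (hf2 h)
  · intro b hb hbX
    by_cases h : ∃ w, Next b w
    · exact hNX (hf1 h) hbX
    · rw [hf2 h] at hbX
      exact h (hNex (hXP ⟨b, hbX⟩) hb)
  · intro y hyX hyf
    have hyP : ∀ a, y ∉ P a := by
      intro a hya
      obtain ⟨i, hi, hiy⟩ := List.getElem_of_mem hya
      obtain ⟨h1, h1'⟩ := hpos a
      rcases i with _ | i
      · exact hyX (by rw [← hiy, h1']; exact a.2)
      · have hN : Next (P a)[i] y := ⟨a, i, hi, rfl, hiy⟩
        exact hyf ⟨_, fun he => D.sinks _ he _ (hNadj hN), hNr (hf1 ⟨_, hN⟩) hN⟩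
    have hye : y ∈ D.exits := by
      by_contra hye
      by_cases h : ∃ w, Next y w
      · obtain ⟨w, a, i, hi, hiy, -⟩ := h
        exact hyP a (hiy ▸ List.getElem_mem (by omega))
      · exact hyf ⟨y, hye, hf2 h⟩
    refine ⟨fun x => if hx : (x : V) ∈ X then P ⟨x, hx⟩ else [y], ?_, ?_⟩
    · rintro ⟨x, hx⟩
      by_cases hxX : x ∈ X
      · simpa only [hxX, dif_pos] using hP ⟨x, hxX⟩
      · obtain rfl : x = y := hx.resolve_right hxX
        simp only [hxX, dif_neg, not_false_eq_true]
        exact ⟨x, hye, by simp [IsPath]⟩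
    · rintro ⟨x, hx⟩ ⟨x', hx'⟩ hne
      by_cases hxX : x ∈ X <;> by_cases hxX' : x' ∈ X
      · simp only [hxX, hxX', dif_pos]
        exact hdisj fun h => hne (by simpa using h)
      · simpa only [hxX, hxX', dif_pos, dif_neg, not_false_eq_true, List.disjoint_singleton]
          using hyP _
      · simpa only [hxX, hxX', dif_pos, dif_neg, not_false_eq_true, List.singleton_disjoint]
          using hyP _
      · exact (hne (Subtype.ext ((hx.resolve_right hxX).trans
          (hx'.resolve_right hxX').symm))).elim

/-- If iterating a shift leads from every vertex that is not a value of it to an exit, then the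
orbits of these vertices form a linkage. -/
lemma IsShift.linkable (hf : D.IsShift f)
    (hreach : ∀ x ∉ f '' D.exitsᶜ, ∃ n, f^[n] x ∈ D.exits) :
    D.Linkable (f '' D.exitsᶜ)ᶜ := by
  classical
  let n : ↑(f '' D.exitsᶜ)ᶜ → ℕ := fun x => Nat.find (hreach x x.2)
  have hn : ∀ x, f^[n x] x ∈ D.exits := fun x => Nat.find_spec (hreach x x.2)
  have hlt : ∀ x i, i < n x → f^[i] x ∉ D.exits := fun x i hi => Nat.find_min _ hi
  have key : ∀ (x y : ↑(f '' D.exitsᶜ)ᶜ) (i j : ℕ), i ≤ n x → j ≤ n y →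
      f^[i] x = f^[j] y → i = j ∧ x = y := by
    intro x y i
    induction i with
    | zero =>
      rintro (_ | j) hi hj he
      · exact ⟨rfl, Subtype.ext he⟩
      · rw [Function.iterate_succ_apply'] at he
        exact (x.2 ⟨_, hlt y j hj, he.symm⟩).elim
    | succ i ih =>
      rintro (_ | j) hi hj he
      · rw [Function.iterate_succ_apply'] at he
        exact (y.2 ⟨_, hlt x i hi, he⟩).elim
      · rw [Function.iterate_succ_apply', Function.iterate_succ_apply'] at he
        obtain ⟨rfl, h⟩ := ih j (by omega) (by omega) (hf.injOn (hlt x i hi) (hlt y j hj) he)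
        exact ⟨rfl, h⟩
  refine ⟨fun x => (List.range (n x + 1)).map fun i => f^[i] x, fun x => ⟨_, hn x, ?_, ?_, ?_, ?_⟩,
    ?_⟩
  · rw [List.isChain_iff_getElem]
    intro i hi
    simp only [List.length_map, List.length_range] at hi
    simp only [List.getElem_map, List.getElem_range]
    have h := hf.adj _ (hlt x i (by omega))
    rw [← Function.iterate_succ_apply' f] at h
    refine h.resolve_left fun he => ?_
    have := (key x x (i + 1) i (by omega) (by omega) he).1
    omega
  · refine List.Nodup.map_on ?_ List.nodup_range
    intro i hi j hj he
    rw [List.mem_range] at hi hj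
    exact (key x x i j (by omega) (by omega) he).1
  · simp [List.range_succ_eq_map]
  · simp [List.range_succ]
  · intro x y hne v hv hv'
    simp only [List.mem_map, List.mem_range] at hv hv'
    obtain ⟨i, hi, rfl⟩ := hv
    obtain ⟨j, hj, he⟩ := hv'
    exact hne (key x y i j (by omega) (by omega) he.symm).2

lemma linkable_exits : D.Linkable D.exits := by
  refine ⟨fun x => [x.1], fun x => ⟨x, x.2, by simp [IsPath]⟩, fun x y hne => ?_⟩
  simpa [Subtype.ext_iff, eq_comm] using hne

lemma eq_exits_of_subset_linkable (hX : D.Linkable X) (h : D.exits ⊆ X) : X = D.exits := by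
  refine h.antisymm' fun x hx => ?_
  obtain ⟨P, hP, hdisj⟩ := hX
  obtain ⟨b, hb, -, -, -, hlast⟩ := hP ⟨x, hx⟩
  obtain ⟨b', hb', -, -, hhead, -⟩ := hP ⟨b, h hb⟩
  by_contra hxe
  have hne : (⟨x, hx⟩ : X) ≠ ⟨b, h hb⟩ := fun he => hxe (by
    rwa [show x = b from congrArg Subtype.val he])
  exact hdisj hne (List.mem_of_getLast? hlast) (List.mem_of_head? hhead)

lemma Linkable.of_equiv {V' : Type*} {D' : Dimaze V'} (e : V ≃ V')
    (hadj : ∀ a b, D.digraph.Adj a b → D'.digraph.Adj (e a) (e b))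
    (hexits : ∀ a ∈ D.exits, e a ∈ D'.exits) (hX : D.Linkable X) : D'.Linkable (e '' X) := by
  obtain ⟨P, hP, hdisj⟩ := hX
  have hmem : ∀ y : ↑(e '' X), e.symm y ∈ X := by
    rintro ⟨_, x, hx, rfl⟩
    simpa using hx
  refine ⟨fun y => (P ⟨e.symm y, hmem y⟩).map e, fun y => ?_, fun y y' hne => ?_⟩
  · obtain ⟨b, hb, hchain, hnd, hhead, hlast⟩ := hP ⟨e.symm y, hmem y⟩
    refine ⟨e b, hexits b hb, ?_, hnd.map e.injective, by simp [hhead], by simp [hlast]⟩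
    exact List.isChain_map_of_isChain e hadj hchain
  · have := @hdisj ⟨e.symm y, hmem y⟩ ⟨e.symm y', hmem y'⟩
      (by simpa [Subtype.ext_iff] using hne)
    intro v hv hv'
    obtain ⟨u, hu, rfl⟩ := List.mem_map.1 hv
    obtain ⟨u', hu', he⟩ := List.mem_map.1 hv'
    exact this hu (e.injective he ▸ hu')

end Dimaze

/-- A strict gammoid on the whole of a type is the matroid of a dimaze on that type. -/
lemma Matroid.IsStrictGammoid.exists_dimaze {α : Type*} {M : Matroid α} (h : M.IsStrictGammoid)
    (hE : M.E = univ) : ∃ D : Dimaze α, ∀ I, M.Indep I ↔ D.Linkable I := by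
  obtain ⟨V, D, e, he⟩ := h
  let e' : α ≃ V := ((Equiv.Set.univ α).symm.trans (Equiv.setCongr hE.symm)).trans e
  let D' : Dimaze α :=
    { digraph := ⟨fun a b => D.digraph.Adj (e' a) (e' b)⟩
      loopless := fun v => D.loopless _
      exits := e' ⁻¹' D.exits
      sinks := fun b hb v => D.sinks _ hb _ }
  refine ⟨D', fun I => ?_⟩
  have h1 := he (Subtype.val ⁻¹' I)
  have h2 : e '' (Subtype.val ⁻¹' I) = e' '' I := by
    ext v
    constructor
    · rintro ⟨x, hx, rfl⟩
      exact ⟨x, hx, rfl⟩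
    · rintro ⟨x, hx, rfl⟩
      exact ⟨⟨x, hE ▸ mem_univ x⟩, hx, rfl⟩
  rw [Subtype.image_preimage_coe, inter_eq_right.2 (hE ▸ subset_univ I), h2] at h1
  rw [h1]
  constructor
  · intro h
    have := h.of_equiv (D' := D') e'.symm (by simp [D']) (by simp [D'])
    simpa using this
  · exact fun h => h.of_equiv e' (fun _ _ h => h) (fun _ h => h)

/-! ### The dual of the matroid of a dimaze -/

namespace Dimaze

variable {V : Type*} {D : Dimaze V} {M : Matroid V} {C : Set V}

lemma isBase_compl_exits (hE : M.E = univ) (hM : ∀ X, M✶.Indep X ↔ D.Linkable X) :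
    M.IsBase D.exitsᶜ := by
  have h : M✶.IsBase D.exits := by
    rw [Matroid.isBase_iff_maximal_indep]
    refine ⟨(hM _).2 linkable_exits, fun X hX hle => ?_⟩
    exact (eq_exits_of_subset_linkable ((hM _).1 hX) hle).le
  simpa [hE, compl_eq_univ_sdiff] using h.compl_isBase_of_dual

/-- Extend the independent set to a base. Its complement is a maximal linkable set, so the shift
along a linkage of it has the whole base as its set of values. -/
lemma matchable_of_indep (hE : M.E = univ) (hM : ∀ X, M✶.Indep X ↔ D.Linkable X)
    (hC : M.Indep C) : D.outGraph.Matchable C := by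
  obtain ⟨B, hB, hCB⟩ := hC.exists_isBase_superset
  have hB' : M✶.IsBase Bᶜ := by
    simpa [hE, compl_eq_univ_sdiff] using hB.compl_isBase_dual
  obtain ⟨f, hf, -, hmax⟩ := ((hM _).1 hB'.indep).exists_isShift
  have hrange : ∀ c ∈ C, ∃ b ∈ D.exitsᶜ, f b = c := by
    intro c hc
    by_contra hcon
    have hcB : c ∉ Bᶜ := fun h => h (hCB hc)
    have h := (hM _).2 (hmax c hcB hcon)
    exact hcB (hB'.eq_of_subset_indep h (subset_insert _ _) ▸ mem_insert c Bᶜ)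
  choose! g hg hfg using hrange
  refine BipartiteGraph.matchable_of_injOn (f := g) (fun a ha b hb hab => ?_) fun c hc => ?_
  · rw [← hfg a ha, hab, hfg b hb]
  · have := hf.outGraph_adj (hg c hc)
    rwa [hfg c hc] at this

/-- The set of vertices `c`, `g c`, `g (g c)`, … for `c ∈ C` an exit, as far as they are
in `C`. -/
inductive Orbit (D : Dimaze V) (C : Set V) (g : V → V) : V → Prop
  | base {c : V} : c ∈ C → c ∈ D.exits → Orbit D C g c
  | step {c : V} : Orbit D C g c → g c ∈ C → Orbit D C g (g c)

/-- Let `g` match the finite set `C` in `D.outGraph`. Matching `g c` to `c` for all `c` in the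
orbits under `g` that start at exits, and every other non-exit to itself, gives a shift with `C`
among its values. It moves only finitely many vertices, so it cannot iterate forever outside the
exits, and its set of values is a spanning set that is, up to a finite exchange of equally many
elements, the base `D.exitsᶜ`. -/
lemma indep_of_matchable (hE : M.E = univ) (hM : ∀ X, M✶.Indep X ↔ D.Linkable X)
    (hCfin : C.Finite) (hC : D.outGraph.Matchable C) : M.Indep C := by
  classical
  rcases C.eq_empty_or_nonempty with rfl | ⟨c₀, -⟩
  · exact M.empty_indep
  have : Nonempty V := ⟨c₀⟩
  obtain ⟨g, hg, hadj⟩ := hC.exists_injOn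
  set U : Set V := {c | Orbit D C g c}
  have hUC : U ⊆ C := by
    rintro c (⟨h, -⟩ | ⟨-, h⟩) <;> exact h
  have hUfin : U.Finite := hCfin.subset hUC
  have hgU : InjOn g U := hg.mono hUC
  have hF : ∀ c ∈ U, g c ∉ D.exits := fun c hc => (hadj c (hUC hc)).1
  have hUF : ∀ c ∈ U, c ∉ D.exits → c ∈ g '' U := by
    rintro c (⟨-, h⟩ | ⟨h, -⟩) hc
    · exact (hc h).elim
    · exact ⟨_, h, rfl⟩
  have hUF' : ∀ c ∈ C, c ∉ U → c ∉ D.exits := fun c hc hcU hce => hcU (.base hc hce)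
  have hFU : ∀ c ∈ C, c ∈ g '' U → c ∈ U := by
    rintro _ hc ⟨u, hu, rfl⟩
    exact Orbit.step hu hc
  let f : V → V := fun b => if h : b ∈ g '' U then h.choose else b
  have hf1 : ∀ c ∈ U, f (g c) = c := by
    intro c hc
    have h : g c ∈ g '' U := ⟨c, hc, rfl⟩
    simp only [f, dif_pos h]
    exact hgU h.choose_spec.1 hc h.choose_spec.2
  have hf2 : ∀ b ∉ g '' U, f b = b := fun b h => by simp only [f, dif_neg h]
  have hshift : D.IsShift f := by
    refine ⟨?_, ?_⟩
    · intro b hb b' hb' he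
      by_cases h : b ∈ g '' U <;> by_cases h' : b' ∈ g '' U
      · obtain ⟨c, hc, rfl⟩ := h
        obtain ⟨c', hc', rfl⟩ := h'
        rw [hf1 c hc, hf1 c' hc'] at he
        rw [he]
      · obtain ⟨c, hc, rfl⟩ := h
        rw [hf1 c hc, hf2 b' h'] at he
        subst he
        exact (h' (hUF c hc hb')).elim
      · obtain ⟨c, hc, rfl⟩ := h'
        rw [hf1 c hc, hf2 b h] at he
        subst he
        exact (h (hUF b hc hb)).elim
      · rwa [hf2 b h, hf2 b' h'] at he
    · intro b hb
      by_cases h : b ∈ g '' U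
      · obtain ⟨c, hc, rfl⟩ := h
        rw [hf1 c hc]
        exact (hadj c (hUC hc)).2
      · exact Or.inl (hf2 b h)
  have himage : f '' D.exitsᶜ = (D.exitsᶜ \ g '' U) ∪ U := by
    ext x
    constructor
    · rintro ⟨b, hb, rfl⟩
      by_cases h : b ∈ g '' U
      · obtain ⟨c, hc, rfl⟩ := h
        rw [hf1 c hc]
        exact Or.inr hc
      · rw [hf2 b h]
        exact Or.inl ⟨hb, h⟩
    · rintro (⟨hb, h⟩ | h)
      · exact ⟨x, hb, hf2 x h⟩
      · exact ⟨g x, hF x h, hf1 x h⟩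
  have hlink : D.Linkable (f '' D.exitsᶜ)ᶜ := by
    refine hshift.linkable fun x hx => ?_
    by_contra! hcon
    -- the orbit of `x` consists of distinct vertices that `f` moves
    have hinj : ∀ i j, f^[i] x = f^[j] x → i = j := by
      intro i
      induction i with
      | zero =>
        rintro (_ | j) he
        · rfl
        · rw [Function.iterate_succ_apply'] at he
          exact (hx ⟨_, hcon j, he.symm⟩).elim
      | succ i ih =>
        rintro (_ | j) he
        · rw [Function.iterate_succ_apply'] at he
          exact (hx ⟨_, hcon i, he⟩).elim
        · rw [Function.iterate_succ_apply', Function.iterate_succ_apply'] at he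
          rw [ih j (hshift.injOn (hcon i) (hcon j) he)]
    refine infinite_range_of_injective (f := fun i => f^[i] x) (fun i j h => hinj i j h)
      ((hUfin.image g).subset ?_)
    rintro _ ⟨i, rfl⟩
    by_contra h
    have h' := hf2 _ h
    rw [← Function.iterate_succ_apply' f] at h'
    have := hinj _ _ h'
    omega
  have hB := isBase_compl_exits hE hM
  obtain ⟨B', hB', hB'sub⟩ := (Matroid.coindep_iff_exists (hE ▸ subset_univ _)).1 ((hM _).2 hlink)
  rw [hE, ← compl_eq_univ_sdiff, compl_compl] at hB'sub
  set S := f '' D.exitsᶜ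
  have hCS : C ⊆ S := by
    intro c hc
    rw [himage]
    by_cases hcU : c ∈ U
    · exact Or.inr hcU
    · exact Or.inl ⟨hUF' c hc hcU, fun h => hcU (hFU c hc h)⟩
  have hSB : S \ D.exitsᶜ = U \ g '' U := by
    rw [himage]
    ext x
    constructor
    · rintro ⟨⟨h1, -⟩ | h1, h2⟩
      · exact (h2 h1).elim
      · exact ⟨h1, fun ⟨c, hc, he⟩ => h2 (he ▸ hF c hc)⟩
    · exact fun ⟨h1, h2⟩ => ⟨Or.inr h1, fun h => h2 (hUF x h1 h)⟩
  have hBS : D.exitsᶜ \ S = g '' U \ U := by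
    rw [himage]
    ext x
    constructor
    · rintro ⟨h1, h2⟩
      by_cases h : x ∈ g '' U
      · exact ⟨h, fun h' => h2 (Or.inr h')⟩
      · exact (h2 (Or.inl ⟨h1, h⟩)).elim
    · rintro ⟨⟨c, hc, rfl⟩, h2⟩
      exact ⟨hF c hc, by rintro (⟨-, h⟩ | h); exacts [h ⟨c, hc, rfl⟩, h2 h]⟩
  have hcard : (S \ D.exitsᶜ).encard = (D.exitsᶜ \ S).encard := by
    rw [hSB, hBS,
      ← encard_eq_encard_iff_encard_sdiff_eq_encard_sdiff (hUfin.subset inter_subset_left),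
      hgU.encard_image]
  have hdiff := hB'.encard_sdiff_comm hB
  have hSBfin : (S \ D.exitsᶜ).Finite := hSB ▸ hUfin.sdiff
  have hB'S : S \ D.exitsᶜ ⊆ B' \ D.exitsᶜ := by
    refine ((hSBfin.subset (sdiff_subset_sdiff_left hB'sub)).eq_of_subset_of_encard_le
      (sdiff_subset_sdiff_left hB'sub) ?_).ge
    rw [hcard, hdiff]
    exact encard_le_encard (sdiff_subset_sdiff_right hB'sub)
  have hBS' : D.exitsᶜ \ B' ⊆ D.exitsᶜ \ S := by
    have hfin : (D.exitsᶜ \ S).Finite := hBS ▸ (hUfin.image g).sdiff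
    refine (hfin.eq_of_subset_of_encard_le (sdiff_subset_sdiff_right hB'sub) ?_).ge
    rw [← hcard, ← hdiff]
    exact encard_le_encard (sdiff_subset_sdiff_left hB'sub)
  refine hB'.indep.subset fun c hc => ?_
  by_cases hce : c ∈ D.exitsᶜ
  · by_contra hcB'
    exact (hBS' ⟨hce, hcB'⟩).2 (hCS hc)
  · exact (hB'S ⟨hCS hc, hce⟩).1

end Dimaze

/-! ### Matchable sets of the example graph -/

/-- The pair `{v_{2j+1}, v_{2j+2}}` of left vertices of `exampleGraph`. For `j > 0` its neighbours
are `A_{j+1}` and `A_{j+2}`; the pair with `j = 0` is joined to `A_3` in addition. -/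
def vertexPair (j : ℕ) : Set ℕ+ := {k | ((k : ℕ) + 1) / 2 = j + 1}

lemma mem_vertexPair {j : ℕ} {k : ℕ+} : k ∈ vertexPair j ↔ ((k : ℕ) + 1) / 2 = j + 1 := Iff.rfl

lemma vertexPair_eq (j : ℕ) :
    vertexPair j = {(2 * j).succPNat, (2 * j + 1).succPNat} := by
  ext k
  simp only [mem_vertexPair, mem_insert_iff, mem_singleton_iff, ← PNat.coe_inj,
    Nat.succPNat_coe, Nat.succ_eq_add_one]
  omega

lemma ncard_vertexPair (j : ℕ) : (vertexPair j).ncard = 2 := by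
  rw [vertexPair_eq, ncard_pair]
  simp [← PNat.coe_inj]

lemma finite_vertexPair (j : ℕ) : (vertexPair j).Finite := by
  rw [vertexPair_eq]
  exact toFinite _

lemma exists_mem_vertexPair (k : ℕ+) : ∃ j, k ∈ vertexPair j :=
  ⟨((k : ℕ) + 1) / 2 - 1, by have := k.pos; rw [mem_vertexPair]; omega⟩

lemma disjoint_vertexPair {i j : ℕ} (h : i ≠ j) : Disjoint (vertexPair i) (vertexPair j) := by
  rw [disjoint_left]
  intro k hi hj
  rw [mem_vertexPair] at hi hj
  omega

lemma ncard_vertexPair_union {i j : ℕ} (h : i ≠ j) :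
    (vertexPair i ∪ vertexPair j).ncard = 4 := by
  rw [ncard_union_eq (disjoint_vertexPair h) (finite_vertexPair i) (finite_vertexPair j),
    ncard_vertexPair, ncard_vertexPair]

lemma exampleGraph_leftLocallyFinite : exampleGraph.LeftLocallyFinite := by
  intro v
  refine (finite_Iic (v + 3)).subset fun (i : ℕ+) hi => ?_
  rw [mem_Iic, ← PNat.coe_le_coe, PNat.add_coe, PNat.val_ofNat]
  simp only [mem_ofPred_eq, exampleGraph, ← PNat.coe_inj, PNat.val_ofNat] at hi
  omega

/-- Matchings that use only the edges from `vertexPair j` to `A_{j+1}` (with `d = 0`) and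
`A_{j+2}` (with `d = 1`). -/
lemma exampleGraph_matchable {C : Set ℕ+} (d : ℕ+ → ℕ) (hd : ∀ k, d k ≤ 1)
    (hinj : ∀ x ∈ C, ∀ y ∈ C, ((x : ℕ) + 1) / 2 + d x = ((y : ℕ) + 1) / 2 + d y → (x : ℕ) = y) :
    exampleGraph.Matchable C := by
  have hpos : ∀ k : ℕ+, 0 < ((k : ℕ) + 1) / 2 + d k := by
    intro k
    have := k.pos
    omega
  refine BipartiteGraph.matchable_of_injOn (f := fun k => ⟨((k : ℕ) + 1) / 2 + d k, hpos k⟩) ?_ ?_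
  · intro x hx y hy he
    exact PNat.coe_inj.1 (hinj x hx y hy (congrArg PNat.val he))
  · intro k _
    have := k.pos
    have := hd k
    simp only [exampleGraph, ← PNat.coe_inj, PNat.val_ofNat, PNat.mk_coe]
    omega

lemma exampleGraph_nbr_consecutive (j : ℕ) :
    exampleGraph.nbr (vertexPair j ∪ vertexPair (j + 1)) ⊆
      {j.succPNat, (j + 1).succPNat, (j + 2).succPNat} := by
  rintro i ⟨k, hk, hi⟩
  simp only [mem_union, mem_vertexPair] at hk
  simp only [exampleGraph, ← PNat.coe_inj, PNat.val_ofNat] at hi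
  simp only [mem_insert_iff, mem_singleton_iff, ← PNat.coe_inj, Nat.succPNat_coe,
    Nat.succ_eq_add_one]
  omega

lemma exampleGraph_not_matchable (j : ℕ) :
    ¬ exampleGraph.Matchable (vertexPair j ∪ vertexPair (j + 1)) := by
  intro h
  have h1 := h.ncard_le ((toFinite _).subset (exampleGraph_nbr_consecutive j))
  have h2 := ncard_le_ncard (exampleGraph_nbr_consecutive j) (toFinite _)
  have h3 := ncard_insert_le j.succPNat {(j + 1).succPNat, (j + 2).succPNat}
  rw [ncard_pair (by simp)] at h3
  rw [ncard_vertexPair_union (by omega)] at h1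
  omega

lemma exampleGraph_matchable_sdiff {j : ℕ} {v : ℕ+} (hv : v ∈ vertexPair j ∪ vertexPair (j + 1)) :
    exampleGraph.Matchable ((vertexPair j ∪ vertexPair (j + 1)) \ {v}) := by
  rcases hv with hv | hv
  · refine exampleGraph_matchable (fun k => if (k : ℕ) = 2 * j + 4 then 1 else 0)
      (fun k => by split_ifs <;> omega) ?_
    intro x hx y hy
    simp only [mem_sdiff, mem_union, mem_vertexPair, mem_singleton_iff, ← PNat.coe_inj] at hx hy hv
    split_ifs <;> omega
  · refine exampleGraph_matchable (fun k => if (k : ℕ) = 2 * j + 1 then 0 else 1)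
      (fun k => by split_ifs <;> omega) ?_
    intro x hx y hy
    simp only [mem_sdiff, mem_union, mem_vertexPair, mem_singleton_iff, ← PNat.coe_inj] at hx hy hv
    split_ifs <;> omega

lemma exampleGraph_matchable_vertexPair_union {j k : ℕ} (h : j + 2 ≤ k) :
    exampleGraph.Matchable (vertexPair j ∪ vertexPair k) := by
  refine exampleGraph_matchable (fun k => ((k : ℕ) + 1) % 2) (fun k => by omega) ?_
  intro x hx y hy
  simp only [mem_union, mem_vertexPair] at hx hy
  omega

lemma exampleGraph_matchable_zero_one {k : ℕ} (h : 3 ≤ k) :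
    exampleGraph.Matchable ((vertexPair 0 ∪ vertexPair k) ∪ {3}) := by
  refine exampleGraph_matchable (fun k => if (k : ℕ) = 3 then 1 else ((k : ℕ) + 1) % 2)
    (fun k => by split_ifs <;> omega) ?_
  intro x hx y hy
  simp only [mem_union, mem_vertexPair, mem_singleton_iff, ← PNat.coe_inj, PNat.val_ofNat] at hx hy
  split_ifs <;> omega

lemma exampleGraph_matchable_zero_one_two :
    exampleGraph.Matchable (vertexPair 0 ∪ {3, 5}) := by
  refine exampleGraph_matchable (fun k => if (k : ℕ) = 1 then 0 else 1)
    (fun k => by split_ifs <;> omega) ?_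
  intro x hx y hy
  simp only [mem_union, mem_vertexPair, mem_insert_iff, mem_singleton_iff, ← PNat.coe_inj,
    PNat.val_ofNat] at hx hy
  split_ifs <;> omega

lemma exampleGraph_matchable_insert_range {t : ℕ → ℕ+} (ht : ∀ j, t j ∈ vertexPair j) {e : ℕ+}
    (he : e ∈ vertexPair 0) : exampleGraph.Matchable (insert e (range t)) := by
  refine exampleGraph_matchable (fun k => if k = e then 0 else 1)
    (fun k => by split_ifs <;> omega) ?_
  intro x hx y hy h
  rw [mem_vertexPair] at he
  by_cases hxe : x = e <;> by_cases hye : y = e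
  · rw [hxe, hye]
  · obtain ⟨j, rfl⟩ := hy.resolve_left hye
    have hj := mem_vertexPair.1 (ht j)
    rw [if_pos hxe, if_neg hye, hxe] at h
    omega
  · obtain ⟨i, rfl⟩ := hx.resolve_left hxe
    have hi := mem_vertexPair.1 (ht i)
    rw [if_neg hxe, if_pos hye, hye] at h
    omega
  · obtain ⟨i, rfl⟩ := hx.resolve_left hxe
    obtain ⟨j, rfl⟩ := hy.resolve_left hye
    have hi := mem_vertexPair.1 (ht i)
    have hj := mem_vertexPair.1 (ht j)
    rw [if_neg hxe, if_neg hye] at h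
    obtain rfl : i = j := by omega
    rfl

/-! ### Graphs with the same finite matchable sets as the example graph -/

section SameFiniteMatchable

variable {W : Type*} [Nonempty W] {H : BipartiteGraph ℕ+ W}

lemma ncard_nbr_consecutive_le
    (hH : ∀ C : Set ℕ+, C.Finite → (H.Matchable C ↔ exampleGraph.Matchable C)) (j : ℕ) :
    (H.nbr (vertexPair j) ∪ H.nbr (vertexPair (j + 1))).Finite ∧
      (H.nbr (vertexPair j) ∪ H.nbr (vertexPair (j + 1))).ncard ≤ 3 := by
  have hfin := (finite_vertexPair j).union (finite_vertexPair (j + 1))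
  have h := BipartiteGraph.finite_and_ncard_nbr_lt_of_circuit (G := H) hfin
    (by rw [hH _ hfin]; exact exampleGraph_not_matchable j)
    (fun v hv => (hH _ hfin.sdiff).2 (exampleGraph_matchable_sdiff hv))
  rw [ncard_vertexPair_union (by omega), BipartiteGraph.nbr_union] at h
  exact ⟨h.1, by omega⟩

lemma finite_nbr_vertexPair
    (hH : ∀ C : Set ℕ+, C.Finite → (H.Matchable C ↔ exampleGraph.Matchable C)) (j : ℕ) :
    (H.nbr (vertexPair j)).Finite :=
  (ncard_nbr_consecutive_le hH j).1.subset subset_union_left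

lemma four_le_ncard_nbr
    (hH : ∀ C : Set ℕ+, C.Finite → (H.Matchable C ↔ exampleGraph.Matchable C)) {j k : ℕ}
    (h : j + 2 ≤ k) : 4 ≤ (H.nbr (vertexPair j) ∪ H.nbr (vertexPair k)).ncard := by
  have hfin := (finite_nbr_vertexPair hH j).union (finite_nbr_vertexPair hH k)
  rw [← BipartiteGraph.nbr_union] at hfin ⊢
  rw [← ncard_vertexPair_union (show j ≠ k by omega)]
  exact ((hH _ ((finite_vertexPair j).union (finite_vertexPair k))).2
    (exampleGraph_matchable_vertexPair_union h)).ncard_le hfin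

lemma three_le_ncard_nbr
    (hH : ∀ C : Set ℕ+, C.Finite → (H.Matchable C ↔ exampleGraph.Matchable C)) {j : ℕ} {v : ℕ+}
    (hv : v ∈ vertexPair j) : 3 ≤ (H.nbr {v} ∪ H.nbr (vertexPair (j + 1))).ncard := by
  have hfin := (finite_vertexPair j).union (finite_vertexPair (j + 1))
  have hv' : v ∉ vertexPair (j + 1) := disjoint_left.1 (disjoint_vertexPair (by omega)) hv
  rw [← BipartiteGraph.nbr_union, singleton_union]
  have h3 : (insert v (vertexPair (j + 1))).ncard = 3 := by
    rw [ncard_insert_of_notMem hv' (finite_vertexPair _), ncard_vertexPair]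
  rw [← h3]
  -- the other member of `vertexPair j`
  obtain ⟨u, hu, huv⟩ : ∃ u ∈ vertexPair j, u ≠ v :=
    exists_ne_of_one_lt_ncard (by rw [ncard_vertexPair]; omega) v
  have hu' : u ∉ vertexPair (j + 1) := disjoint_left.1 (disjoint_vertexPair (by omega)) hu
  have hm : H.Matchable (insert v (vertexPair (j + 1))) := by
    refine ((hH _ hfin.sdiff).2 (exampleGraph_matchable_sdiff (Or.inl hu))).mono ?_
    rintro x (rfl | hx)
    · exact ⟨Or.inl hv, fun h => huv (h.symm)⟩
    · exact ⟨Or.inr hx, fun h => hu' (h ▸ hx)⟩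
  refine hm.ncard_le ((ncard_nbr_consecutive_le hH j).1.subset ?_)
  rw [← BipartiteGraph.nbr_union]
  exact BipartiteGraph.nbr_mono (insert_subset (Or.inl hv) subset_union_right)

/-- With `N i` the set of neighbours of `vertexPair i`: if `N (j + 1)` had three elements, it
would contain `N j` and `N (j + 2)`, which have at least four elements between them. -/
lemma ncard_nbr_vertexPair_succ
    (hH : ∀ C : Set ℕ+, C.Finite → (H.Matchable C ↔ exampleGraph.Matchable C)) (j : ℕ) :
    (H.nbr (vertexPair (j + 1))).ncard = 2 := by
  have hfin := finite_nbr_vertexPair hH (j + 1)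
  refine le_antisymm ?_ ?_
  · by_contra! hcon
    obtain ⟨hf1, h1⟩ := ncard_nbr_consecutive_le hH j
    obtain ⟨hf2, h2⟩ := ncard_nbr_consecutive_le hH (j + 1)
    have e1 := eq_of_subset_of_ncard_le
      (subset_union_right (s := H.nbr (vertexPair j)) (t := H.nbr (vertexPair (j + 1))))
      (by omega) hf1
    have e2 := eq_of_subset_of_ncard_le
      (subset_union_left (s := H.nbr (vertexPair (j + 1))) (t := H.nbr (vertexPair (j + 1 + 1))))
      (by omega) hf2
    have h3 := four_le_ncard_nbr hH (le_refl (j + 2))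
    have h4 := ncard_le_ncard (union_subset (e1 ▸ subset_union_left) (e2 ▸ subset_union_right) :
      H.nbr (vertexPair j) ∪ H.nbr (vertexPair (j + 2)) ⊆ H.nbr (vertexPair (j + 1))) hfin
    rw [← e1] at h1
    omega
  · rw [← ncard_vertexPair (j + 1)]
    exact (((hH _ ((finite_vertexPair (j + 1)).union (finite_vertexPair (j + 3)))).2
      (exampleGraph_matchable_vertexPair_union (by omega))).mono subset_union_left).ncard_le
      (finite_nbr_vertexPair hH (j + 1))

lemma ncard_nbr_consecutive
    (hH : ∀ C : Set ℕ+, C.Finite → (H.Matchable C ↔ exampleGraph.Matchable C)) (j : ℕ) :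
    (H.nbr (vertexPair j) ∪ H.nbr (vertexPair (j + 1))).ncard = 3 := by
  obtain ⟨hf, h⟩ := ncard_nbr_consecutive_le hH j
  obtain ⟨v, hv⟩ : (vertexPair j).Nonempty :=
    nonempty_of_ncard_ne_zero (by rw [ncard_vertexPair]; omega)
  refine le_antisymm h ((three_le_ncard_nbr hH hv).trans (ncard_le_ncard ?_ hf))
  exact union_subset_union_left _ (BipartiteGraph.nbr_mono (singleton_subset_iff.2 hv))

/-- The analogue of `A_{j+1}` in `H`: the neighbour of `vertexPair j` that is not a neighbour
of `vertexPair (j + 1)`. -/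
lemma exists_nbr_sdiff_eq_singleton
    (hH : ∀ C : Set ℕ+, C.Finite → (H.Matchable C ↔ exampleGraph.Matchable C)) (j : ℕ) :
    ∃ a, H.nbr (vertexPair j) \ H.nbr (vertexPair (j + 1)) = {a} := by
  rw [← ncard_eq_one, ← union_sdiff_right]
  have h1 := ncard_sdiff_add_ncard_of_subset
    (subset_union_right (s := H.nbr (vertexPair j)) (t := H.nbr (vertexPair (j + 1))))
    (ncard_nbr_consecutive_le hH j).1
  rw [ncard_nbr_consecutive hH, ncard_nbr_vertexPair_succ hH] at h1
  omega

lemma adj_of_nbr_sdiff_eq_singleton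
    (hH : ∀ C : Set ℕ+, C.Finite → (H.Matchable C ↔ exampleGraph.Matchable C)) {j : ℕ} {a : W}
    (ha : H.nbr (vertexPair j) \ H.nbr (vertexPair (j + 1)) = {a}) {v : ℕ+}
    (hv : v ∈ vertexPair j) : H.Adj v a := by
  obtain ⟨w, hw, hw'⟩ : ∃ w ∈ H.nbr {v}, w ∉ H.nbr (vertexPair (j + 1)) := by
    by_contra! hcon
    have h := three_le_ncard_nbr hH hv
    rw [union_eq_self_of_subset_left hcon, ncard_nbr_vertexPair_succ hH] at h
    omega
  have hwa : w = a := by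
    rw [← mem_singleton_iff, ← ha]
    exact ⟨BipartiteGraph.nbr_mono (singleton_subset_iff.2 hv) hw, hw'⟩
  obtain ⟨_, rfl, hw⟩ := hw
  exact hwa ▸ hw

lemma notMem_nbr_of_mem_nbr
    (hH : ∀ C : Set ℕ+, C.Finite → (H.Matchable C ↔ exampleGraph.Matchable C)) {j k : ℕ}
    (hjk : j + 2 ≤ k) {w : W} (hw : w ∈ H.nbr (vertexPair (j + 1))) :
    w ∉ H.nbr (vertexPair (k + 1)) := by
  intro hw'
  have h1 := ncard_union_add_ncard_inter (H.nbr (vertexPair (j + 1))) (H.nbr (vertexPair (k + 1)))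
    (finite_nbr_vertexPair hH _) (finite_nbr_vertexPair hH _)
  rw [ncard_nbr_vertexPair_succ hH, ncard_nbr_vertexPair_succ hH] at h1
  have h2 := four_le_ncard_nbr hH (show j + 1 + 2 ≤ k + 1 by omega)
  have h3 := (ncard_pos ((finite_nbr_vertexPair hH (j + 1)).subset inter_subset_left)).2
    ⟨w, hw, hw'⟩
  omega

lemma exists_eq_of_mem_nbr
    (hH : ∀ C : Set ℕ+, C.Finite → (H.Matchable C ↔ exampleGraph.Matchable C)) {a : ℕ → W}
    (ha : ∀ j, H.nbr (vertexPair j) \ H.nbr (vertexPair (j + 1)) = {a j}) {j : ℕ} {w : W}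
    (hw : w ∈ H.nbr (vertexPair j)) : ∃ i, a i = w := by
  have hstep : ∀ i, w ∈ H.nbr (vertexPair i) → a i ≠ w → w ∈ H.nbr (vertexPair (i + 1)) := by
    intro i hi hne
    by_contra hcon
    have : w ∈ ({a i} : Set W) := ha i ▸ ⟨hi, hcon⟩
    exact hne (mem_singleton_iff.1 this).symm
  by_contra! hcon
  have h1 := hstep j hw (hcon j)
  exact notMem_nbr_of_mem_nbr hH (le_refl _) h1
    (hstep _ (hstep _ h1 (hcon _)) (hcon _))

lemma ncard_nbr_inter
    (hH : ∀ C : Set ℕ+, C.Finite → (H.Matchable C ↔ exampleGraph.Matchable C)) (j : ℕ) :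
    (H.nbr (vertexPair (j + 1)) ∩ H.nbr (vertexPair (j + 2))).ncard = 1 := by
  have h1 := ncard_union_add_ncard_inter (H.nbr (vertexPair (j + 1))) (H.nbr (vertexPair (j + 2)))
    (finite_nbr_vertexPair hH _) (finite_nbr_vertexPair hH _)
  rw [ncard_nbr_vertexPair_succ hH, ncard_nbr_vertexPair_succ hH, ncard_nbr_consecutive hH] at h1
  omega

/-- Although `vertexPair 0` may have a third neighbour, the one that it does not share with
`vertexPair 1` belongs to it alone. -/
lemma notMem_nbr_of_nbr_sdiff_eq_singleton
    (hH : ∀ C : Set ℕ+, C.Finite → (H.Matchable C ↔ exampleGraph.Matchable C)) {a : W}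
    (ha : H.nbr (vertexPair 0) \ H.nbr (vertexPair 1) = {a}) {k : ℕ} (hk : k ≠ 0) :
    a ∉ H.nbr (vertexPair k) := by
  intro hak
  have ha1 : a ∉ H.nbr (vertexPair 1) := (ha.ge rfl).2
  have hsub : H.nbr (vertexPair 0) ⊆ H.nbr (vertexPair 1) ∪ H.nbr (vertexPair k) := by
    intro w hw
    by_cases hw1 : w ∈ H.nbr (vertexPair 1)
    · exact Or.inl hw1
    · obtain rfl : w = a := mem_singleton_iff.1 (ha ▸ ⟨hw, hw1⟩)
      exact Or.inr hak
  have hfin := (finite_nbr_vertexPair hH 1).union (finite_nbr_vertexPair hH k)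
  have h3 : (3 : ℕ+) ∈ vertexPair 1 := by simp [mem_vertexPair]
  obtain rfl | rfl | hk3 : k = 1 ∨ k = 2 ∨ 3 ≤ k := by omega
  · exact ha1 hak
  · have h5 : (5 : ℕ+) ∈ vertexPair 2 := by simp [mem_vertexPair]
    have hC : (vertexPair 0 ∪ {3, 5}).ncard = 4 := by
      rw [ncard_union_eq _ (finite_vertexPair _), ncard_vertexPair, ncard_pair]
      · decide
      · rw [disjoint_left]
        simp only [mem_vertexPair, mem_insert_iff, mem_singleton_iff, ← PNat.coe_inj,
          PNat.val_ofNat]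
        omega
    have hnbr : H.nbr (vertexPair 0 ∪ {3, 5}) ⊆ H.nbr (vertexPair 1) ∪ H.nbr (vertexPair 2) := by
      rw [BipartiteGraph.nbr_union]
      refine union_subset hsub ?_
      rw [← BipartiteGraph.nbr_union]
      exact BipartiteGraph.nbr_mono (pair_subset (Or.inl h3) (Or.inr h5))
    have h1 := ((hH _ ((finite_vertexPair 0).union (toFinite _))).2
      exampleGraph_matchable_zero_one_two).ncard_le (hfin.subset hnbr)
    have h2 := ncard_le_ncard hnbr hfin
    have h4 := ncard_nbr_consecutive hH 1
    simp only [Nat.reduceAdd] at h4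
    omega
  · obtain ⟨k, rfl⟩ : ∃ l, k = l + 1 := ⟨k - 1, by omega⟩
    have hC : ((vertexPair 0 ∪ vertexPair (k + 1)) ∪ {3}).ncard = 5 := by
      rw [ncard_union_eq _ ((finite_vertexPair _).union (finite_vertexPair _)),
        ncard_vertexPair_union (by omega), ncard_singleton]
      rw [disjoint_left]
      simp only [mem_union, mem_vertexPair, mem_singleton_iff, ← PNat.coe_inj, PNat.val_ofNat]
      omega
    have hnbr : H.nbr ((vertexPair 0 ∪ vertexPair (k + 1)) ∪ {3}) ⊆
        H.nbr (vertexPair 1) ∪ H.nbr (vertexPair (k + 1)) := by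
      rw [BipartiteGraph.nbr_union, BipartiteGraph.nbr_union]
      refine union_subset (union_subset hsub subset_union_right) ?_
      exact (BipartiteGraph.nbr_mono (singleton_subset_iff.2 h3)).trans subset_union_left
    have h1 := ((hH _ (((finite_vertexPair 0).union (finite_vertexPair _)).union (toFinite _))).2
      (exampleGraph_matchable_zero_one hk3)).ncard_le (hfin.subset hnbr)
    have h2 := ncard_le_ncard hnbr hfin
    have h4 := ncard_union_le (H.nbr (vertexPair 1)) (H.nbr (vertexPair (k + 1)))
    rw [show (H.nbr (vertexPair 1)).ncard = 2 from ncard_nbr_vertexPair_succ hH 0,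
      ncard_nbr_vertexPair_succ hH] at h4
    omega

end SameFiniteMatchable

/-! ### No dimaze defines the dual -/

/-- Let `a j` be the neighbour of `vertexPair j` in `D.outGraph` that is not shared with
`vertexPair (j + 1)`. Each `vertexPair j` without an exit contains `a j`: otherwise both its
members, being non-exits and so their own neighbours, would be shared with
`vertexPair (j + 1)`. -/
lemma mem_vertexPair_of_disjoint_exits {D : Dimaze ℕ+}
    (hH : ∀ C : Set ℕ+, C.Finite → (D.outGraph.Matchable C ↔ exampleGraph.Matchable C))
    {a : ℕ → ℕ+}
    (ha : ∀ j, D.outGraph.nbr (vertexPair j) \ D.outGraph.nbr (vertexPair (j + 1)) = {a j})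
    {j : ℕ} (hj : ∀ v ∈ vertexPair j, v ∉ D.exits) : a j ∈ vertexPair j := by
  by_contra hcon
  have hself : ∀ {i v}, v ∈ vertexPair i → v ∉ D.exits → v ∈ D.outGraph.nbr (vertexPair i) :=
    fun {i v} hv hve => ⟨v, hv, hve, Or.inl rfl⟩
  have haj := (ha j).ge rfl
  have hae : a j ∉ D.exits := by
    obtain ⟨v, -, h, -⟩ := haj.1
    exact h
  have hsub : vertexPair j ⊆
      D.outGraph.nbr (vertexPair j) ∩ D.outGraph.nbr (vertexPair (j + 1)) := by
    intro v hv
    refine ⟨hself hv (hj v hv), ?_⟩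
    by_contra h
    have : v ∈ ({a j} : Set ℕ+) := ha j ▸ ⟨hself hv (hj v hv), h⟩
    exact hcon (mem_singleton_iff.1 this ▸ hv)
  rcases j with _ | j
  · obtain ⟨k, hk⟩ := exists_mem_vertexPair (a 0)
    have hk0 : k ≠ 0 := fun h => hcon (h ▸ hk)
    exact notMem_nbr_of_nbr_sdiff_eq_singleton hH (ha 0) hk0 (hself hk hae)
  · have h := ncard_le_ncard hsub ((finite_nbr_vertexPair hH _).subset inter_subset_left)
    rw [ncard_vertexPair, ncard_nbr_inter hH] at h
    omega

/-- From each pair choose an exit if there is one, and `a j` otherwise. The shift that sends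
`a j` to the vertex chosen from `vertexPair j` reaches an exit in one step from each vertex that
is not chosen, so the complement of the chosen transversal is linkable. -/
lemma exists_linkable_compl_subset {D : Dimaze ℕ+}
    (hH : ∀ C : Set ℕ+, C.Finite → (D.outGraph.Matchable C ↔ exampleGraph.Matchable C)) :
    ∃ t : ℕ → ℕ+, (∀ j, t j ∈ vertexPair j) ∧ ∃ S ⊆ range t, D.Linkable Sᶜ := by
  choose a ha using exists_nbr_sdiff_eq_singleton hH
  have ht : ∀ j, ∃ v ∈ vertexPair j, v ∈ D.exits ∨ v = a j := by
    intro j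
    by_cases h : ∃ v ∈ vertexPair j, v ∈ D.exits
    · obtain ⟨v, hv, hve⟩ := h
      exact ⟨v, hv, Or.inl hve⟩
    · push Not at h
      exact ⟨a j, mem_vertexPair_of_disjoint_exits hH ha h, Or.inr rfl⟩
  choose t ht hta using ht
  have hidx : ∀ b ∉ D.exits, ∃ j, a j = b := by
    intro b hb
    obtain ⟨j, hj⟩ := exists_mem_vertexPair b
    exact exists_eq_of_mem_nbr hH ha (j := j) ⟨b, hj, hb, Or.inl rfl⟩
  choose! idx hidx using hidx
  have hf : D.IsShift (t ∘ idx) := by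
    refine ⟨fun b hb b' hb' he => ?_, fun b hb => ?_⟩
    · have h : idx b = idx b' := by
        by_contra hne
        exact disjoint_left.1 (disjoint_vertexPair hne) (ht (idx b))
          ((show t (idx b) = t (idx b') from he) ▸ ht (idx b'))
      rw [← hidx b hb, h, hidx b' hb']
    · have h := (adj_of_nbr_sdiff_eq_singleton hH (ha (idx b)) (ht (idx b))).2
      rwa [hidx b hb] at h
  refine ⟨t, ht, _, ?_, hf.linkable fun x hx => ?_⟩
  · rintro _ ⟨b, -, rfl⟩
    exact ⟨_, rfl⟩
  · by_cases hxe : x ∈ D.exits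
    · exact ⟨0, hxe⟩
    · refine ⟨1, (hta (idx x)).resolve_right fun h => hx ⟨x, hxe, ?_⟩⟩
      exact h.trans (hidx x hxe)

lemma not_isStrictGammoid_dual {M : Matroid ℕ+} (hM : exampleGraph.IsTransversalMatroidOf M) :
    ¬ (M✶).IsStrictGammoid := by
  intro hstrict
  obtain ⟨hE, hind⟩ := hM
  obtain ⟨D, hD⟩ := hstrict.exists_dimaze (by rw [Matroid.dual_ground, hE])
  have hH : ∀ C : Set ℕ+, C.Finite → (D.outGraph.Matchable C ↔ exampleGraph.Matchable C) :=
    fun C hC => ⟨fun h => (hind C).1 (Dimaze.indep_of_matchable hE hD hC h),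
      fun h => Dimaze.matchable_of_indep hE hD ((hind C).2 h)⟩
  obtain ⟨t, ht, S, hSt, hS⟩ := exists_linkable_compl_subset hH
  obtain ⟨B, hB, hBS⟩ := (Matroid.coindep_iff_exists (hE ▸ subset_univ _)).1 ((hD _).2 hS)
  rw [hE, ← compl_eq_univ_sdiff, compl_compl] at hBS
  obtain ⟨e, he, het⟩ : ∃ e ∈ vertexPair 0, e ≠ t 0 :=
    exists_ne_of_one_lt_ncard (by rw [ncard_vertexPair]; omega) (t 0)
  have hins := hB.eq_of_subset_indep ((hind _).2 (exampleGraph_matchable_insert_range ht he))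
    ((hBS.trans hSt).trans (subset_insert _ _))
  obtain ⟨j, rfl⟩ := hSt (hBS (hins.ge (mem_insert e _)))
  have hj : j = 0 := by
    have := ht j
    rw [mem_vertexPair] at this he
    omega
  exact het (by rw [hj])

theorem mainTheorem11 :
    exampleGraph.LeftLocallyFinite ∧
    ∃ M : Matroid ℕ+, exampleGraph.IsTransversalMatroidOf M ∧ M.Finitary ∧
      ¬ (M✶).IsStrictGammoid := by
  obtain ⟨M, hM, hfin⟩ := exampleGraph_leftLocallyFinite.exists_matroid
  exact ⟨exampleGraph_leftLocallyFinite, M, hM, hfin, not_isStrictGammoid_dual hM⟩
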